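/- Let $T$ be a positive integer and, for $1\le t\le T$, let $\mathcal X_t,\mathcal Y_t$ be closed subsets of $\mathbb R^d$ (or, more generally, non-empty Polish spaces). Put $\mathcal X=\mathcal X_1\times\dots\times\mathcal X_T$, $\mathcal Y=\mathcal Y_1\times\dots\times\mathcal Y_T$ with the product topologies, write $x_{s:t}=(x_s,\dots,x_t)$, $\mathcal X_{s:t}=\mathcal X_s\times\dots\times\mathcal X_t$ (similarly for $y$ and $\mathcal Y$), and let $\mathcal P(\cdot)$ denote the Borel probability measures and $C_b(\cdot)$ the bounded continuous real functions. Fix $\hat\mu\in\mathcal P(\mathcal X)$ with conditional laws $\hat\mu(dx_{t+1:T}\mid x_{1:t})$. For $\nu\in\mathcal P(\mathcal Y)$ let $\Pi(\hat\mu,\nu)$ be the set of couplings of $\hat\mu$ and $\nu$, and let $\Pi_c(\hat\mu,\nu)$ be the set of those $\pi\in\Pi(\hat\mu,\nu)$ that are causal, i.e. $\pi(dy_{1:t}\mid x_{1:T})=\pi(dy_{1:t}\mid x_{1:t})$ almost surely for $t=1,\dots,T-1$. Let $c:\mathcal X\times\mathcal Y\to[0,\infty)$ be lower semicontinuous, let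 $f:\mathcal Y\to\mathbb R$ be upper semicontinuous and bounded from above, and put $$\mathcal W_c(\hat\mu,\nu)=\inf_{\pi\in\Pi_c(\hat\mu,\nu)}\int c\,d\pi,\qquad \mathcal B_\varepsilon=\{\nu\in\mathcal P(\mathcal Y):\mathcal W_c(\hat\mu,\nu)\le\varepsilon\}.$$ Let $\Gamma$ be the set of functions $\gamma:\mathcal X\times\mathcal Y\to\mathbb R$ of the form $$\gamma(x,y)=\sum_{l=1}^{L}\sum_{t=1}^{T-1}h_{l,t}(y_{1:t})\Big[g_{l,t}(x_{1:T})-\int g_{l,t}(x_{1:t},x'_{t+1:T})\,\hat\mu(dx'_{t+1:T}\mid x_{1:t})\Big]$$ with a positive integer $L$, $h_{l,t}\in C_b(\mathcal Y_{1:t})$ and $g_{l,t}\in C_b(\mathcal X)$. Let $\varepsilon>0$ be such that $\mathcal B_\varepsilon\neq\emptyset$, and let $\mathcal V\subset\mathcal P(\mathcal Y)$ be non-empty. Then $$\sup_{\nu\in\mathcal B_\varepsilon\cap\mathcal V}\int_{\mathcal Y} f\,d\nu=\sup_{\nu\in\mathcal V}\ \inf_{\lambda\ge 0,\ \gamma\in\Gamma}\Big\{\lambda\varepsilon+\sup_{\pi\in\Pi(\hat\mu,\nu)}\int_{\mathcal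 X\times\mathcal Y}\big[f(y)-\lambda c(x,y)+\gamma(x,y)\big]\,\pi(dx,dy)\Big\},$$ where integrals of functions bounded from above, suprema and infima take values in $[-\infty,\infty]$, and $\sup\emptyset=-\infty$. -/

import Mathlib

open MeasureTheory ProbabilityTheory
open scoped NNReal ENNReal BoundedContinuousFunction

noncomputable section

namespace SCOT

/-- Paths `x = x_{1:T}`; the time `t` in `1, …, T` is the index `t - 1 : Fin T`. -/
abbrev Path {T : ℕ} (X : Fin T → Type*) := ∀ t, X t

/-- The space of the initial segments `x_{1:t}`. -/
abbrev Past {T : ℕ} (X : Fin T → Type*) (t : Fin T) := ∀ s : Finset.Iic t, X s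

/-- The space of the final segments `x_{t+1:T}`. -/
abbrev Future {T : ℕ} (X : Fin T → Type*) (t : Fin T) := ∀ s : Finset.Ioi t, X s

/-- The initial segment `x_{1:t}` of a path. -/
def past {T : ℕ} {X : Fin T → Type*} (t : Fin T) (x : Path X) : Past X t := fun s => x s

/-- The final segment `x_{t+1:T}` of a path. -/
def future {T : ℕ} {X : Fin T → Type*} (t : Fin T) (x : Path X) : Future X t := fun s => x s

/-- The path `(x_{1:t}, x_{t+1:T})` with given initial and final segments. -/
def glue {T : ℕ} {X : Fin T → Type*} (t : Fin T) (a : Past X t) (b : Future X t) : Path X :=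
  fun s => if hs : s ≤ t then a ⟨s, Finset.mem_Iic.2 hs⟩
    else b ⟨s, Finset.mem_Ioi.2 (not_le.1 hs)⟩

/-- The times `1, …, T - 1`. -/
def innerTimes (T : ℕ) : Finset (Fin T) := Finset.univ.filter (fun t => (t : ℕ) + 1 < T)

/-- The integral of a real function with values in `[-∞, ∞]`, as the integral of the positive part
minus the integral of the negative part. It is used for measurable functions that are bounded above,
whose positive part has a finite integral. -/
def eintegral {α : Type*} [MeasurableSpace α] (μ : Measure α) (g : α → ℝ) : EReal :=
  ((∫⁻ a, ENNReal.ofReal (g a) ∂μ : ℝ≥0∞) : EReal) -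
    ((∫⁻ a, ENNReal.ofReal (-g a) ∂μ : ℝ≥0∞) : EReal)

/-- The set `Π(μ, ν)` of couplings of `μ` and `ν`. -/
def couplings {α β : Type*} [MeasurableSpace α] [MeasurableSpace β]
    (μ : ProbabilityMeasure α) (ν : ProbabilityMeasure β) : Set (ProbabilityMeasure (α × β)) :=
  {π | (π : Measure (α × β)).fst = (μ : Measure α) ∧ (π : Measure (α × β)).snd = (ν : Measure β)}

/-- Causality of a plan `π`: for `t = 1, …, T - 1`, the conditional law of `y_{1:t}` given `x_{1:T}`
equals its conditional law given `x_{1:t}`. -/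
def IsCausal {T : ℕ} {X Y : Fin T → Type*}
    [∀ t, MeasurableSpace (X t)]
    [∀ t, MeasurableSpace (Y t)] [∀ t, StandardBorelSpace (Y t)] [∀ t, Nonempty (Y t)]
    (π : ProbabilityMeasure (Path X × Path Y)) : Prop :=
  ∀ t ∈ innerTimes T, ∀ᵐ x ∂(π : Measure (Path X × Path Y)).fst,
    condDistrib (fun p : Path X × Path Y => past t p.2) (fun p => p.1)
        (π : Measure (Path X × Path Y)) x =
      condDistrib (fun p : Path X × Path Y => past t p.2) (fun p => past t p.1)
        (π : Measure (Path X × Path Y)) (past t x)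

/-- The causal transport cost: the infimum of `∫ c dπ` over the causal couplings `π` of `μ`
and `ν`. -/
def causalCost {T : ℕ} {X Y : Fin T → Type*}
    [∀ t, MeasurableSpace (X t)]
    [∀ t, MeasurableSpace (Y t)] [∀ t, StandardBorelSpace (Y t)] [∀ t, Nonempty (Y t)]
    (c : Path X × Path Y → ℝ≥0)
    (μ : ProbabilityMeasure (Path X)) (ν : ProbabilityMeasure (Path Y)) : ℝ≥0∞ :=
  ⨅ π ∈ {π ∈ couplings μ ν | IsCausal π},
    ∫⁻ p, (c p : ℝ≥0∞) ∂(π : Measure (Path X × Path Y))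

/-- The causal Wasserstein ball of radius `ε` around `μ`. -/
def causalBall {T : ℕ} {X Y : Fin T → Type*}
    [∀ t, MeasurableSpace (X t)]
    [∀ t, MeasurableSpace (Y t)] [∀ t, StandardBorelSpace (Y t)] [∀ t, Nonempty (Y t)]
    (c : Path X × Path Y → ℝ≥0) (μ : ProbabilityMeasure (Path X)) (ε : ℝ) :
    Set (ProbabilityMeasure (Path Y)) :=
  {ν | causalCost c μ ν ≤ ENNReal.ofReal ε}

/-- The function `x ↦ ∫ g(x_{1:t}, x'_{t+1:T}) μ(dx'_{t+1:T} | x_{1:t})`. -/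
def condMean {T : ℕ} {X : Fin T → Type*}
    [∀ t, MeasurableSpace (X t)] [∀ t, StandardBorelSpace (X t)] [∀ t, Nonempty (X t)]
    (μ : ProbabilityMeasure (Path X)) (t : Fin T) (g : Path X → ℝ) (x : Path X) : ℝ :=
  ∫ z, g (glue t (past t x) z)
    ∂(condDistrib (future t) (past t) (μ : Measure (Path X)) (past t x))

/-- The space `Γ` of test functions. -/
def testFunctions {T : ℕ} {X : Fin T → Type*} (Y : Fin T → Type*)
    [∀ t, TopologicalSpace (X t)] [∀ t, MeasurableSpace (X t)]
    [∀ t, StandardBorelSpace (X t)] [∀ t, Nonempty (X t)]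
    [∀ t, TopologicalSpace (Y t)]
    (μ : ProbabilityMeasure (Path X)) : Set (Path X → Path Y → ℝ) :=
  {γ | ∃ (L : ℕ) (h : Fin L → ∀ t : Fin T, Past Y t →ᵇ ℝ) (g : Fin L → Fin T → (Path X →ᵇ ℝ)),
    0 < L ∧ ∀ x y, γ x y =
      ∑ l, ∑ t ∈ innerTimes T, h l t (past t y) * (g l t x - condMean μ t (g l t) x)}

/-- The structural primal value: the supremum of `∫ f dν` over `ν` in the causal ball and in `V`. -/
def primalValue {T : ℕ} {X Y : Fin T → Type*}
    [∀ t, MeasurableSpace (X t)]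
    [∀ t, MeasurableSpace (Y t)] [∀ t, StandardBorelSpace (Y t)] [∀ t, Nonempty (Y t)]
    (f : Path Y → ℝ) (c : Path X × Path Y → ℝ≥0) (μ : ProbabilityMeasure (Path X)) (ε : ℝ)
    (V : Set (ProbabilityMeasure (Path Y))) : EReal :=
  ⨆ ν ∈ causalBall c μ ε ∩ V, eintegral (ν : Measure (Path Y)) f

/-- The structural dual value. -/
def dualValue {T : ℕ} {X Y : Fin T → Type*}
    [∀ t, TopologicalSpace (X t)] [∀ t, MeasurableSpace (X t)]
    [∀ t, StandardBorelSpace (X t)] [∀ t, Nonempty (X t)]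
    [∀ t, TopologicalSpace (Y t)] [∀ t, MeasurableSpace (Y t)]
    (f : Path Y → ℝ) (c : Path X × Path Y → ℝ≥0) (μ : ProbabilityMeasure (Path X)) (ε : ℝ)
    (V : Set (ProbabilityMeasure (Path Y))) : EReal :=
  ⨆ ν ∈ V, ⨅ (lam : ℝ≥0) (γ ∈ testFunctions Y μ),
    (((lam : ℝ) * ε : ℝ) : EReal) +
      ⨆ π ∈ couplings μ ν, eintegral (π : Measure (Path X × Path Y))
        (fun p => f p.2 - (lam : ℝ) * (c p : ℝ) + γ p.1 p.2)

end SCOT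

end

/-!
The supremum over `ν ∈ V` stands on both sides, so the claim is one about a fixed `ν`: the inner
infimum over `λ` and `γ` equals `∫ f dν` if `ν` lies in the causal ball, and `-∞` otherwise.

The link between `Γ` and causality is that a coupling `π` of `μ` and `ν` is causal if and only if
`∫ γ dπ = 0` for all `γ ∈ Γ` (`integral_test_eq_zero_of_causal`,
`isCausal_of_integral_test_eq_zero`). Indeed `condMean` is a conditional expectation given
`x_{1:t}`, and products `g(x) h(y_{1:t})` of bounded continuous functions determine the joint law of
`x` and `y_{1:t}`.

If `ν` is in the ball, the choice `λ = 0`, `γ = 0` gives `≤`; causal couplings of cost arbitrarily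
close to `ε`, which annihilate `Γ`, give `≥` (`eintegral_le_penalised`).

If `ν` is not in the ball, then every coupling that annihilates `Γ` costs more than `ε`. The
couplings form a compact set (`isCompact_couplings`), on which the cost is lower semicontinuous
(`lowerSemicontinuous_lintegral`) and `π ↦ ∫ γ dπ` is continuous. The latter holds although `γ` is
only measurable in `x`, because the first marginal is fixed (`continuousOn_integral_mul`). By
compactness finitely many test functions already force the cost above `ε`, and the separation of a
point from a closed convex epigraph in a finite-dimensional space yields a multiplier `λ > 0` and a
`γ ∈ Γ` with `λ (ε - ∫ c dπ) + ∫ γ dπ ≤ -δ < 0` for all couplings of finite cost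
(`exists_multipliers`). Scaling `λ` and `γ` up drives the dual value to `-∞`
(`exists_penalised_le`), since `f` is bounded above and couplings of infinite cost contribute `-∞`.
-/

noncomputable section

namespace SCOT

open Filter Topology

/-! ### Extended integrals -/

section ExtendedIntegral

variable {α β : Type*} [MeasurableSpace α] [MeasurableSpace β]

lemma eintegral_eq_integral {μ : Measure α} {g : α → ℝ} (hg : Integrable g μ) :
    eintegral μ g = ((∫ a, g a ∂μ : ℝ) : EReal) := by
  have hpos : ∫⁻ a, ENNReal.ofReal (g a) ∂μ ≠ ⊤ := hg.lintegral_lt_top.ne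
  have hneg : ∫⁻ a, ENNReal.ofReal (-g a) ∂μ ≠ ⊤ := hg.neg.lintegral_lt_top.ne
  rw [integral_eq_lintegral_pos_part_sub_lintegral_neg_part hg, eintegral, EReal.coe_sub,
    EReal.coe_ennreal_toReal hpos, EReal.coe_ennreal_toReal hneg]

lemma eintegral_mono {μ : Measure α} {g g' : α → ℝ} (h : ∀ a, g a ≤ g' a) :
    eintegral μ g ≤ eintegral μ g' := by
  refine EReal.sub_le_sub ?_ ?_
  · exact EReal.coe_ennreal_le_coe_ennreal_iff.2
      (lintegral_mono fun a => ENNReal.ofReal_le_ofReal (h a))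
  · exact EReal.coe_ennreal_le_coe_ennreal_iff.2
      (lintegral_mono fun a => ENNReal.ofReal_le_ofReal (neg_le_neg (h a)))

lemma eintegral_eq_bot {μ : Measure α} {g : α → ℝ}
    (h : ∫⁻ a, ENNReal.ofReal (-g a) ∂μ = ⊤) : eintegral μ g = ⊥ := by
  simp [eintegral, h]

lemma eintegral_map {μ : Measure α} {φ : α → β} (hφ : Measurable φ) {g : β → ℝ}
    (hg : Measurable g) : eintegral (μ.map φ) g = eintegral μ (fun a => g (φ a)) := by
  rw [eintegral, eintegral, lintegral_map (by fun_prop) hφ, lintegral_map (by fun_prop) hφ]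

/-- A measurable function bounded above is integrable as soon as its extended integral is not
`-∞`. -/
lemma integrable_of_eintegral_ne_bot {μ : Measure α} [IsFiniteMeasure μ] {g : α → ℝ}
    (hg : Measurable g) {C : ℝ} (hC : ∀ a, g a ≤ C) (h : eintegral μ g ≠ ⊥) :
    Integrable g μ := by
  have hneg : ∫⁻ a, ENNReal.ofReal (-g a) ∂μ ≠ ⊤ := fun h' => h (eintegral_eq_bot h')
  refine ⟨hg.aestronglyMeasurable, ?_⟩
  rw [hasFiniteIntegral_iff_norm]
  have hle : ∀ a, ENNReal.ofReal ‖g a‖ ≤ ENNReal.ofReal C + ENNReal.ofReal (-g a) := by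
    intro a
    rcases le_total 0 (g a) with h0 | h0
    · rw [Real.norm_of_nonneg h0]
      exact (ENNReal.ofReal_le_ofReal (hC a)).trans le_self_add
    · rw [Real.norm_of_nonpos h0]
      exact le_add_self
  calc ∫⁻ a, ENNReal.ofReal ‖g a‖ ∂μ
      ≤ ∫⁻ a, (ENNReal.ofReal C + ENNReal.ofReal (-g a)) ∂μ := lintegral_mono hle
    _ = ENNReal.ofReal C * μ Set.univ + ∫⁻ a, ENNReal.ofReal (-g a) ∂μ := by
        rw [lintegral_add_left measurable_const, lintegral_const]
    _ < ⊤ := ENNReal.add_lt_top.2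
        ⟨ENNReal.mul_lt_top ENNReal.ofReal_lt_top (measure_lt_top _ _), hneg.lt_top⟩

lemma integrable_coe_of_lintegral_ne_top {μ : Measure α} {c : α → ℝ≥0} (hc : Measurable c)
    (h : ∫⁻ a, (c a : ℝ≥0∞) ∂μ ≠ ⊤) : Integrable (fun a => (c a : ℝ)) μ := by
  refine ⟨hc.coe_nnreal_real.aestronglyMeasurable, ?_⟩
  rw [hasFiniteIntegral_iff_ofReal (.of_forall fun a => NNReal.coe_nonneg (c a))]
  simpa using Ne.lt_top h

lemma integral_coe_eq_toReal_lintegral {μ : Measure α} {c : α → ℝ≥0} (hc : Measurable c) :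
    ∫ a, (c a : ℝ) ∂μ = (∫⁻ a, (c a : ℝ≥0∞) ∂μ).toReal := by
  rw [integral_eq_lintegral_of_nonneg_ae (.of_forall fun a => NNReal.coe_nonneg (c a))
    hc.coe_nnreal_real.aestronglyMeasurable]
  simp

/-- Subtracting a positive multiple of a cost with infinite integral from a bounded function makes
the extended integral `-∞`. -/
lemma eintegral_sub_mul_eq_bot {μ : Measure α} [IsFiniteMeasure μ] {g : α → ℝ}
    {c : α → ℝ≥0} (hc : Measurable c) {C lam : ℝ} (hC : ∀ a, g a ≤ C) (hlam : 0 < lam)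
    (h : ∫⁻ a, (c a : ℝ≥0∞) ∂μ = ⊤) : eintegral μ (fun a => g a - lam * (c a : ℝ)) = ⊥ := by
  apply eintegral_eq_bot
  by_contra hne
  have hle : ∀ a, ENNReal.ofReal lam * (c a : ℝ≥0∞) ≤
      ENNReal.ofReal C + ENNReal.ofReal (-(g a - lam * (c a : ℝ))) := by
    intro a
    rw [← ENNReal.ofReal_coe_nnreal, ← ENNReal.ofReal_mul hlam.le]
    refine le_trans (ENNReal.ofReal_le_ofReal ?_) ENNReal.ofReal_add_le
    linarith [hC a]
  have h1 := lintegral_mono (μ := μ) hle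
  rw [lintegral_const_mul _ (by fun_prop), h,
    ENNReal.mul_top (by simpa using hlam), lintegral_add_left measurable_const,
    lintegral_const, top_le_iff, ENNReal.add_eq_top] at h1
  rcases h1 with h1 | h1
  · exact (ENNReal.mul_lt_top ENNReal.ofReal_lt_top (measure_lt_top μ _)).ne h1
  · exact hne h1

end ExtendedIntegral

/-! ### Lagrange multipliers on compact convex sets -/

section Minimax

/-- The epigraph of `C` over the map `(A i)_i`, as a subset of a finite-dimensional space, is
closed when the parameter space is compact. -/
lemma isClosed_epigraph_over {K ι : Type*} [TopologicalSpace K] [CompactSpace K]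
    {A : ι → K → ℝ} (hA : ∀ i, Continuous (A i)) {C : K → ℝ≥0∞} (hC : LowerSemicontinuous C) :
    IsClosed {z : (ι → ℝ) × ℝ |
      ∃ p, (fun i => A i p) = z.1 ∧ C p ≤ ENNReal.ofReal z.2 ∧ 0 ≤ z.2} := by
  have hcl : IsClosed {q : K × ((ι → ℝ) × ℝ) |
      (fun i => A i q.1) = q.2.1 ∧ C q.1 ≤ ENNReal.ofReal q.2.2 ∧ 0 ≤ q.2.2} := by
    refine (isClosed_eq ?_ ?_).inter (IsClosed.inter ?_
      (isClosed_Ici.preimage (f := fun q : K × ((ι → ℝ) × ℝ) => q.2.2) (by fun_prop)))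
    · exact continuous_pi fun i => (hA i).comp continuous_fst
    · fun_prop
    · have hepi := hC.isClosed_epigraph
      exact hepi.preimage (f := fun q : K × ((ι → ℝ) × ℝ) => (q.1, ENNReal.ofReal q.2.2))
        (continuous_fst.prodMk (ENNReal.continuous_ofReal.comp (by fun_prop)))
  have := isClosedMap_snd_of_compactSpace _ hcl
  convert this using 1
  ext z
  simp

/-- **Lagrange multipliers on a compact convex set.** Let `A i` be continuous affine functions and
`C` a lower semicontinuous convex function with values in `[0, ∞]` on a compact set, on which
convexity is expressed through the existence of mixtures. If `C > ε` wherever all the constraints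
`A i = 0` hold, then a finite combination of the constraints and a positive multiplier for `C`
witness this uniformly. -/
theorem exists_multipliers {K ι : Type*} [TopologicalSpace K] [CompactSpace K]
    {A : ι → K → ℝ} (hA : ∀ i, Continuous (A i)) {C : K → ℝ≥0∞} (hC : LowerSemicontinuous C)
    (hmix : ∀ p q : K, ∀ a b : ℝ, 0 ≤ a → 0 ≤ b → a + b = 1 → ∃ r : K,
      (∀ i, A i r = a * A i p + b * A i q) ∧
        C r ≤ ENNReal.ofReal a * C p + ENNReal.ofReal b * C q)
    {ε : ℝ} (hε : 0 ≤ ε) (h : ∀ p, (∀ i, A i p = 0) → ENNReal.ofReal ε < C p) :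
    ∃ (s : Finset ι) (w : ι → ℝ) (lam δ : ℝ), 0 < lam ∧ 0 < δ ∧ ∀ p, C p ≠ ⊤ →
      lam * (ε - (C p).toReal) + ∑ i ∈ s, w i * A i p ≤ -δ := by
  classical
  by_cases hfin : ∃ p, C p ≠ ⊤
  swap
  · push Not at hfin
    exact ⟨∅, 0, 1, 1, one_pos, one_pos, fun p hp => absurd (hfin p) hp⟩
  obtain ⟨p₀, hp₀⟩ := hfin
  -- By compactness, finitely many of the constraints already force `C > ε`.
  obtain ⟨s, hs⟩ : ∃ s : Finset ι, {p | C p ≤ ENNReal.ofReal ε} ∩ ⋂ i ∈ s, {p | A i p = 0} = ∅ := by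
    refine (hC.isClosed_preimage _).isCompact.elim_finite_subfamily_closed _
      (fun i => isClosed_eq (hA i) continuous_const) ?_
    ext p
    simp only [Set.mem_inter_iff, Set.mem_iInter, Set.mem_empty_iff_false, iff_false, not_and]
    intro hp hall
    exact absurd (h p hall) (not_lt.2 hp)
  let S : Set ((s → ℝ) × ℝ) :=
    {z | ∃ p, (fun i : s => A i p) = z.1 ∧ C p ≤ ENNReal.ofReal z.2 ∧ 0 ≤ z.2}
  have hScl : IsClosed S := isClosed_epigraph_over (A := fun i : s => A i) (fun i => hA i) hC
  have hSconv : Convex ℝ S := by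
    rintro ⟨v, r⟩ ⟨p, hv, hp, hr⟩ ⟨v', r'⟩ ⟨q, hv', hq, hr'⟩ a b ha hb hab
    obtain ⟨m, hm, hCm⟩ := hmix p q a b ha hb hab
    dsimp only at hv hv' hp hq hr hr'
    refine ⟨m, ?_, ?_, ?_⟩
    · ext i
      simp [hm, ← hv, ← hv']
    · refine hCm.trans ?_
      have : (a • (v, r) + b • (v', r')).2 = a * r + b * r' := by simp
      rw [this, ENNReal.ofReal_add (by positivity) (by positivity), ENNReal.ofReal_mul ha,
        ENNReal.ofReal_mul hb]
      gcongr
    · simp only [Prod.snd_add, Prod.smul_snd, smul_eq_mul]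
      positivity
  have hnot : ((0 : s → ℝ), ε) ∉ S := by
    rintro ⟨p, hv, hp, -⟩
    have : p ∈ ({p | C p ≤ ENNReal.ofReal ε} ∩ ⋂ i ∈ s, {p | A i p = 0}) := by
      refine ⟨hp, ?_⟩
      simp only [Set.mem_iInter]
      intro i hi
      exact congrFun hv ⟨i, hi⟩
    rw [hs] at this
    exact this
  obtain ⟨F, u, hFS, hFu⟩ := geometric_hahn_banach_closed_point hSconv hScl hnot
  set β : ℝ := F (0, 1) with hβ
  have hFform : ∀ (v : s → ℝ) (r : ℝ),
      F (v, r) = ∑ i, F (Pi.single i 1, 0) * v i + r * β := by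
    intro v r
    have h1 : (v, r) = (∑ i, v i • ((Pi.single i (1 : ℝ) : s → ℝ), (0 : ℝ))) + r • (0, 1) := by
      ext i
      · simp [Prod.fst_sum, Finset.sum_apply, Pi.single_apply]
      · simp [Prod.snd_sum]
    rw [h1, map_add, map_sum, map_smul, smul_eq_mul]
    congr 1
    exact Finset.sum_congr rfl fun i _ => by rw [map_smul, smul_eq_mul, mul_comm]
  have hε' : F (0, ε) = ε * β := by rw [hFform]; simp
  rw [hε'] at hFu
  have hmem : ∀ p, C p ≠ ⊤ → ∀ r, (C p).toReal ≤ r → ((fun i : s => A i p), r) ∈ S := by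
    intro p hp r hr
    exact ⟨p, rfl, (ENNReal.le_ofReal_iff_toReal_le hp (ENNReal.toReal_nonneg.trans hr)).2 hr,
      ENNReal.toReal_nonneg.trans hr⟩
  -- The epigraph is unbounded upwards, so the separating functional cannot increase in `r`.
  have hβ0 : β ≤ 0 := by
    by_contra! hpos
    set B := ∑ i : s, F (Pi.single i 1, 0) * A i p₀ with hB
    have h1 := hFS _ (hmem p₀ hp₀ (max (C p₀).toReal ((u - B) / β)) (le_max_left _ _))
    rw [hFform] at h1
    have h2 : (u - B) / β ≤ max (C p₀).toReal ((u - B) / β) := le_max_right _ _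
    rw [div_le_iff₀ hpos] at h2
    linarith
  set δ := ε * β - u with hδ
  have hδ0 : 0 < δ := by linarith
  set η := δ / (2 * (ε + 1)) with hη
  have hη0 : 0 < η := by positivity
  -- A small extra multiplier `η` makes the multiplier of `C` positive.
  have hηε : η * ε ≤ δ / 2 := by
    have : η * (ε + 1) = δ / 2 := by rw [hη]; field_simp
    nlinarith
  refine ⟨s, fun i => if hi : i ∈ s then F (Pi.single ⟨i, hi⟩ 1, 0) else 0, -β + η, δ / 2,
    by linarith, by linarith, fun p hp => ?_⟩
  have h1 := hFS _ (hmem p hp _ le_rfl)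
  rw [hFform] at h1
  have h2 : ∑ i ∈ s, (if hi : i ∈ s then F (Pi.single ⟨i, hi⟩ 1, 0) else 0) * A i p =
      ∑ i : s, F (Pi.single i 1, 0) * A i p := by
    rw [← Finset.sum_coe_sort s]
    exact Finset.sum_congr rfl fun i _ => by simp
  rw [h2]
  have h3 : 0 ≤ η * (C p).toReal := mul_nonneg hη0.le ENNReal.toReal_nonneg
  nlinarith

end Minimax

/-! ### The weak topology on couplings -/

section Couplings

/-- The integral of a nonnegative lower semicontinuous function is lower semicontinuous for weak
convergence of probability measures. -/
lemma lowerSemicontinuous_lintegral {Ω : Type*} [TopologicalSpace Ω] [PolishSpace Ω]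
    [MeasurableSpace Ω] [BorelSpace Ω] {c : Ω → ℝ≥0} (hc : LowerSemicontinuous c) :
    LowerSemicontinuous (fun π : ProbabilityMeasure Ω => ∫⁻ a, (c a : ℝ≥0∞) ∂(π : Measure Ω)) := by
  have hopen : ∀ t : ℝ, IsOpen {a | t < (c a : ℝ)} := by
    intro t
    rcases lt_or_ge t 0 with ht | ht
    · convert isOpen_univ
      ext a
      simpa using ht.trans_le (c a).2
    · convert hc.isOpen_preimage (⟨t, ht⟩ : ℝ≥0) using 1
      exact Set.ext fun a => Iff.rfl
  have hcm : Measurable c := hc.measurable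
  have key : ∀ π : ProbabilityMeasure Ω, ∫⁻ a, (c a : ℝ≥0∞) ∂(π : Measure Ω) =
      ∫⁻ t in Set.Ioi (0 : ℝ), (π : Measure Ω) {a | t < (c a : ℝ)} := by
    intro π
    rw [← lintegral_eq_lintegral_meas_lt (π : Measure Ω) (f := fun a => (c a : ℝ))
      (Eventually.of_forall fun a => (c a).2) hcm.coe_nnreal_real.aemeasurable]
    simp
  rw [lowerSemicontinuous_iff_isClosed_preimage]
  intro y
  apply IsSeqClosed.isClosed
  intro u π hu hlim
  simp only [Set.mem_preimage, Set.mem_Iic] at hu ⊢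
  calc ∫⁻ a, (c a : ℝ≥0∞) ∂(π : Measure Ω)
      = ∫⁻ t in Set.Ioi (0 : ℝ), (π : Measure Ω) {a | t < (c a : ℝ)} := key π
    _ ≤ ∫⁻ t in Set.Ioi (0 : ℝ), liminf (fun n => (u n : Measure Ω) {a | t < (c a : ℝ)}) atTop :=
        lintegral_mono fun t =>
          ProbabilityMeasure.le_liminf_measure_open_of_tendsto hlim (hopen t)
    _ ≤ liminf (fun n => ∫⁻ t in Set.Ioi (0 : ℝ), (u n : Measure Ω) {a | t < (c a : ℝ)}) atTop :=
        lintegral_liminf_le fun n => Antitone.measurable fun s t hst =>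
          measure_mono fun ω hω => lt_of_le_of_lt hst hω
    _ ≤ y := by
        refine liminf_le_of_frequently_le' (Frequently.of_forall fun n => ?_)
        rw [← key]
        exact hu n

variable {α β : Type*} [MeasurableSpace α] [MeasurableSpace β]

lemma integral_fst_of_mem_couplings {μ : ProbabilityMeasure α} {ν : ProbabilityMeasure β}
    {π : ProbabilityMeasure (α × β)} (hπ : π ∈ couplings μ ν) {k : α → ℝ} (hk : Measurable k) :
    ∫ p, k p.1 ∂(π : Measure (α × β)) = ∫ x, k x ∂(μ : Measure α) := by
  rw [← hπ.1, Measure.fst, integral_map measurable_fst.aemeasurable hk.aestronglyMeasurable]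

/-- Convex combinations of couplings are couplings. -/
lemma exists_mixture {μ : ProbabilityMeasure α} {ν : ProbabilityMeasure β}
    {π ρ : ProbabilityMeasure (α × β)} (hπ : π ∈ couplings μ ν) (hρ : ρ ∈ couplings μ ν)
    {a b : ℝ} (ha : 0 ≤ a) (hb : 0 ≤ b) (hab : a + b = 1) :
    ∃ σ ∈ couplings μ ν, (σ : Measure (α × β)) =
      ENNReal.ofReal a • (π : Measure (α × β)) + ENNReal.ofReal b • (ρ : Measure (α × β)) := by
  have hsum : ENNReal.ofReal a + ENNReal.ofReal b = 1 := by
    rw [← ENNReal.ofReal_add ha hb, hab, ENNReal.ofReal_one]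
  refine ⟨⟨ENNReal.ofReal a • (π : Measure (α × β)) + ENNReal.ofReal b • (ρ : Measure (α × β)),
    ⟨by simp [hsum]⟩⟩, ⟨?_, ?_⟩, rfl⟩
  · change Measure.map Prod.fst (_ + _) = _
    have h1 : (π : Measure (α × β)).map Prod.fst = μ := hπ.1
    have h2 : (ρ : Measure (α × β)).map Prod.fst = μ := hρ.1
    rw [Measure.map_add _ _ measurable_fst, Measure.map_smul, Measure.map_smul, h1, h2,
      ← add_smul, hsum, one_smul]
  · change Measure.map Prod.snd (_ + _) = _
    have h1 : (π : Measure (α × β)).map Prod.snd = ν := hπ.2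
    have h2 : (ρ : Measure (α × β)).map Prod.snd = ν := hρ.2
    rw [Measure.map_add _ _ measurable_snd, Measure.map_smul, Measure.map_smul, h1, h2,
      ← add_smul, hsum, one_smul]

variable [TopologicalSpace α] [PolishSpace α] [BorelSpace α]
  [TopologicalSpace β] [PolishSpace β] [BorelSpace β]

lemma isClosed_couplings (μ : ProbabilityMeasure α) (ν : ProbabilityMeasure β) :
    IsClosed (couplings μ ν) := by
  have h1 : Continuous fun π : ProbabilityMeasure (α × β) => π.map measurable_fst.aemeasurable :=
    ProbabilityMeasure.continuous_map continuous_fst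
  have h2 : Continuous fun π : ProbabilityMeasure (α × β) => π.map measurable_snd.aemeasurable :=
    ProbabilityMeasure.continuous_map continuous_snd
  have hcl := (isClosed_eq h1 (continuous_const (y := μ))).inter
    (isClosed_eq h2 (continuous_const (y := ν)))
  convert hcl using 1
  ext π
  exact and_congr (Subtype.ext_iff (a1 := π.map measurable_fst.aemeasurable) (a2 := μ)).symm
    (Subtype.ext_iff (a1 := π.map measurable_snd.aemeasurable) (a2 := ν)).symm

/-- Couplings of two fixed laws form a weakly compact set, by Prokhorov's theorem. -/
lemma isCompact_couplings (μ : ProbabilityMeasure α) (ν : ProbabilityMeasure β) :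
    IsCompact (couplings μ ν) := by
  have ht : IsTightMeasureSet
      {((π : ProbabilityMeasure (α × β)) : Measure (α × β)) | π ∈ couplings μ ν} := by
    apply IsTightMeasureSet.prodMk
    · refine IsTightMeasureSet.subset (isTightMeasureSet_singleton (μ := (μ : Measure α))) ?_
      rintro _ ⟨_, ⟨π, hπ, rfl⟩, rfl⟩
      exact hπ.1
    · refine IsTightMeasureSet.subset (isTightMeasureSet_singleton (μ := (ν : Measure β))) ?_
      rintro _ ⟨_, ⟨π, hπ, rfl⟩, rfl⟩
      exact hπ.2
  have := isCompact_closure_of_isTightMeasureSet ht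
  rwa [(isClosed_couplings μ ν).closure_eq] at this

/-- On the couplings of two fixed laws, weak convergence upgrades to convergence of the integrals
of products of a bounded continuous function of `y` and a function of `x` that is merely integrable
for the first marginal, because such a function is an `L¹`-limit of bounded continuous ones. -/
lemma continuousOn_integral_mul (μ : ProbabilityMeasure α) (ν : ProbabilityMeasure β)
    (h : β →ᵇ ℝ) {k : α → ℝ} (hk : Integrable k (μ : Measure α)) :
    ContinuousOn (fun π : ProbabilityMeasure (α × β) =>
      ∫ p, h p.2 * k p.1 ∂(π : Measure (α × β))) (couplings μ ν) := by
  apply continuousOn_of_uniform_approx_of_continuousOn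
  intro u hu
  obtain ⟨e, he, heu⟩ := Metric.mem_uniformity_dist.1 hu
  set e' := e / (2 * (‖h‖ + 1)) with he'
  have he'0 : 0 < e' := by positivity
  obtain ⟨k', hk', hk'int⟩ := hk.exists_boundedContinuous_integral_sub_le he'0
  refine ⟨fun π => ∫ p, h p.2 * k' p.1 ∂(π : Measure (α × β)), ?_, fun π hπ => heu ?_⟩
  · exact (ProbabilityMeasure.continuous_integral_boundedContinuousFunction
      ((h.compContinuous ⟨Prod.snd, continuous_snd⟩) *
        (k'.compContinuous ⟨Prod.fst, continuous_fst⟩) : α × β →ᵇ ℝ)).continuousOn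
  have hfst : MeasurePreserving Prod.fst (π : Measure (α × β)) (μ : Measure α) :=
    ⟨measurable_fst, hπ.1⟩
  have hbd : ∀ᵐ p ∂(π : Measure (α × β)), ‖h p.2‖ ≤ ‖h‖ := .of_forall fun p => h.norm_coe_le_norm _
  have hmeas : AEStronglyMeasurable (fun p : α × β => h p.2) (π : Measure (α × β)) :=
    (h.continuous.comp continuous_snd).aestronglyMeasurable
  have i1 : Integrable (fun p : α × β => h p.2 * k p.1) (π : Measure (α × β)) :=
    (hfst.integrable_comp_of_integrable hk).bdd_mul hmeas hbd
  have i2 : Integrable (fun p : α × β => h p.2 * k' p.1) (π : Measure (α × β)) :=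
    (hfst.integrable_comp_of_integrable hk'int).bdd_mul hmeas hbd
  have i3 : Integrable (fun p : α × β => ‖k p.1 - k' p.1‖) (π : Measure (α × β)) :=
    (hfst.integrable_comp_of_integrable (hk.sub hk'int)).norm
  rw [Real.dist_eq, ← integral_sub i1 i2, ← Real.norm_eq_abs]
  have hmap : ∫ p, ‖k p.1 - k' p.1‖ ∂(π : Measure (α × β)) = ∫ x, ‖k x - k' x‖ ∂(μ : Measure α) := by
    rw [← hfst.map_eq, integral_map hfst.aemeasurable]
    rw [hfst.map_eq]
    exact (hk.sub hk'int).1.norm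
  calc ‖∫ p, (h p.2 * k p.1 - h p.2 * k' p.1) ∂(π : Measure (α × β))‖
      ≤ ∫ p, ‖h p.2 * k p.1 - h p.2 * k' p.1‖ ∂(π : Measure (α × β)) :=
        norm_integral_le_integral_norm _
    _ ≤ ∫ p, ‖h‖ * ‖k p.1 - k' p.1‖ ∂(π : Measure (α × β)) := by
        refine integral_mono (i1.sub i2).norm (i3.const_mul _) fun p => ?_
        dsimp only
        rw [← mul_sub, norm_mul]
        gcongr
        exact h.norm_coe_le_norm _
    _ = ‖h‖ * ∫ x, ‖k x - k' x‖ ∂(μ : Measure α) := by rw [integral_const_mul, hmap]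
    _ ≤ ‖h‖ * e' := by gcongr
    _ < e := by
        have : e' * (‖h‖ + 1) = e / 2 := by rw [he']; field_simp
        nlinarith [norm_nonneg h]

end Couplings

/-! ### Segments of paths -/

section Segments

variable {T : ℕ} {X : Fin T → Type*}

lemma glue_past_future (t : Fin T) (x : Path X) : glue t (past t x) (future t x) = x := by
  ext s
  by_cases hs : s ≤ t <;> simp [glue, past, future, hs]

lemma measurable_past [∀ t, MeasurableSpace (X t)] (t : Fin T) :
    Measurable (past t : Path X → Past X t) :=
  measurable_pi_lambda _ fun _ => measurable_pi_apply _

lemma measurable_future [∀ t, MeasurableSpace (X t)] (t : Fin T) :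
    Measurable (future t : Path X → Future X t) :=
  measurable_pi_lambda _ fun _ => measurable_pi_apply _

lemma measurable_glue [∀ t, MeasurableSpace (X t)] (t : Fin T) :
    Measurable (fun p : Past X t × Future X t => glue t p.1 p.2) := by
  refine measurable_pi_lambda _ fun s => ?_
  by_cases hs : s ≤ t
  · simp only [glue, hs, dite_true]
    exact (measurable_pi_apply _).comp measurable_fst
  · simp only [glue, hs, dite_false]
    exact (measurable_pi_apply _).comp measurable_snd

lemma continuous_past [∀ t, TopologicalSpace (X t)] (t : Fin T) :
    Continuous (past t : Path X → Past X t) :=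
  continuous_pi fun _ => continuous_apply _

variable {Y : Fin T → Type*}

lemma measurable_past_snd [∀ t, MeasurableSpace (X t)] [∀ t, MeasurableSpace (Y t)]
    (t : Fin T) : Measurable (fun p : Path X × Path Y => past t p.2) :=
  (measurable_past t).comp measurable_snd

lemma measurable_past_fst [∀ t, MeasurableSpace (X t)] [∀ t, MeasurableSpace (Y t)]
    (t : Fin T) : Measurable (fun p : Path X × Path Y => past t p.1) :=
  (measurable_past t).comp measurable_fst

end Segments

/-! ### Disintegration and conditional means -/

section Conditioning

/-- Disintegration of the joint law of `U` and `Z` along `U`. -/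
lemma integral_eq_integral_condDistrib {Ω β ζ : Type*} [MeasurableSpace Ω] [MeasurableSpace β]
    [MeasurableSpace ζ] [StandardBorelSpace ζ] [Nonempty ζ] {P : Measure Ω} [IsFiniteMeasure P]
    {U : Ω → β} {Z : Ω → ζ} (hU : Measurable U) (hZ : Measurable Z) {F : β × ζ → ℝ}
    (hF : Measurable F) {C : ℝ} (hC : ∀ q, ‖F q‖ ≤ C) :
    ∫ ω, F (U ω, Z ω) ∂P = ∫ ω, ∫ z, F (U ω, z) ∂(condDistrib Z U P (U ω)) ∂P := by
  have hUZ : Measurable fun ω => (U ω, Z ω) := hU.prodMk hZ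
  have hint : Integrable F (P.map fun ω => (U ω, Z ω)) :=
    Integrable.of_bound hF.aestronglyMeasurable C (.of_forall hC)
  rw [← integral_map (φ := fun ω => (U ω, Z ω)) hUZ.aemeasurable hF.aestronglyMeasurable,
    ← compProd_map_condDistrib hZ.aemeasurable, Measure.integral_compProd
      (by rwa [compProd_map_condDistrib hZ.aemeasurable])]
  exact integral_map hU.aemeasurable
    (hF.stronglyMeasurable.integral_condDistrib).aestronglyMeasurable

lemma norm_integral_le_of_bound {ζ : Type*} [MeasurableSpace ζ] {P : Measure ζ}
    [IsProbabilityMeasure P] {h : ζ → ℝ} {C : ℝ} (hC : ∀ z, ‖h z‖ ≤ C) : ‖∫ z, h z ∂P‖ ≤ C := by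
  simpa using norm_integral_le_of_norm_le_const (μ := P) (.of_forall hC)

variable {T : ℕ} {X : Fin T → Type*} [∀ t, TopologicalSpace (X t)] [∀ t, PolishSpace (X t)]
    [∀ t, MeasurableSpace (X t)] [∀ t, BorelSpace (X t)] [∀ t, Nonempty (X t)]

/-- The conditional mean as a function of the initial segment. -/
def pastMean (μ : ProbabilityMeasure (Path X)) (t : Fin T) (g : Path X → ℝ) (a : Past X t) : ℝ :=
  ∫ z, g (glue t a z) ∂(condDistrib (future t) (past t) (μ : Measure (Path X)) a)

variable (μ : ProbabilityMeasure (Path X)) (t : Fin T)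

lemma measurable_pastMean {g : Path X → ℝ} (hg : Measurable g) : Measurable (pastMean μ t g) :=
  (StronglyMeasurable.integral_condDistrib (μ := (μ : Measure (Path X))) (X := past t)
    (Y := future t) (f := fun p => g (glue t p.1 p.2))
    (hg.comp (measurable_glue t)).stronglyMeasurable).measurable

lemma measurable_condMean {g : Path X → ℝ} (hg : Measurable g) : Measurable (condMean μ t g) :=
  (measurable_pastMean μ t hg).comp (measurable_past t)

lemma norm_condMean_le {g : Path X → ℝ} {C : ℝ} (hC : ∀ x, ‖g x‖ ≤ C) (x : Path X) :
    ‖condMean μ t g x‖ ≤ C :=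
  norm_integral_le_of_bound fun _ => hC _

/-- `condMean` is a conditional expectation given the initial segment. -/
lemma integral_mul_condMean {φ : Past X t → ℝ} (hφ : Measurable φ) {B : ℝ} (hB : ∀ a, ‖φ a‖ ≤ B)
    {g : Path X → ℝ} (hg : Measurable g) {C : ℝ} (hC : ∀ x, ‖g x‖ ≤ C) :
    ∫ x, φ (past t x) * condMean μ t g x ∂(μ : Measure (Path X)) =
      ∫ x, φ (past t x) * g x ∂(μ : Measure (Path X)) := by
  have hbound : ∀ p : Past X t × Future X t, ‖φ p.1 * g (glue t p.1 p.2)‖ ≤ B * C := by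
    intro p
    rw [norm_mul]
    exact mul_le_mul (hB _) (hC _) (norm_nonneg _) ((norm_nonneg _).trans (hB p.1))
  have h := integral_eq_integral_condDistrib (P := (μ : Measure (Path X))) (measurable_past t)
    (measurable_future t) (F := fun p => φ p.1 * g (glue t p.1 p.2))
    ((hφ.comp measurable_fst).mul (hg.comp (measurable_glue t))) hbound
  simp only [glue_past_future, integral_const_mul] at h
  exact h.symm

end Conditioning

/-! ### Conditioning along a plan -/

section Plans

variable {T : ℕ} {X Y : Fin T → Type*} [∀ t, MeasurableSpace (X t)]
    [∀ t, TopologicalSpace (Y t)] [∀ t, PolishSpace (Y t)]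
    [∀ t, MeasurableSpace (Y t)] [∀ t, BorelSpace (Y t)]

lemma integrable_past_mul {t : Fin T} (h : Past Y t →ᵇ ℝ) {k : Path X → ℝ} (hk : Measurable k)
    {C : ℝ} (hC : ∀ x, ‖k x‖ ≤ C) (P : Measure (Path X × Path Y)) [IsFiniteMeasure P] :
    Integrable (fun p => h (past t p.2) * k p.1) P := by
  refine Integrable.of_bound (((h.continuous.measurable.comp (measurable_past_snd t)).mul
    (hk.comp measurable_fst)).aestronglyMeasurable) (‖h‖ * C) (.of_forall fun p => ?_)
  rw [norm_mul]
  exact mul_le_mul (h.norm_coe_le_norm _) (hC _) (norm_nonneg _) (norm_nonneg _)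

end Plans

section ResponseMean

variable {T : ℕ} {X Y : Fin T → Type*} [∀ t, MeasurableSpace (X t)] [∀ t, MeasurableSpace (Y t)]
    [∀ t, StandardBorelSpace (Y t)] [∀ t, Nonempty (Y t)]
    {π : ProbabilityMeasure (Path X × Path Y)}

/-- The conditional mean of `h (y_{1:t})` given `x_{1:t}` under the plan `π`. -/
def responseMean (π : ProbabilityMeasure (Path X × Path Y)) (t : Fin T) (h : Past Y t → ℝ)
    (a : Past X t) : ℝ :=
  ∫ y, h y ∂(condDistrib (fun p : Path X × Path Y => past t p.2) (fun p => past t p.1)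
    (π : Measure (Path X × Path Y)) a)

lemma measurable_responseMean (t : Fin T) {h : Past Y t → ℝ} (hh : Measurable h) :
    Measurable (responseMean π t h) :=
  (StronglyMeasurable.integral_condDistrib (μ := (π : Measure (Path X × Path Y)))
    (X := fun p => past t p.1) (Y := fun p => past t p.2) (f := fun q => h q.2)
    (hh.comp measurable_snd).stronglyMeasurable).measurable

end ResponseMean

/-! ### Test functions characterise causality -/

section Causality

variable {T : ℕ} {X Y : Fin T → Type*} [∀ t, MeasurableSpace (X t)]
    [∀ t, TopologicalSpace (Y t)] [∀ t, PolishSpace (Y t)]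
    [∀ t, MeasurableSpace (Y t)] [∀ t, BorelSpace (Y t)] [∀ t, Nonempty (Y t)]
    {μ : ProbabilityMeasure (Path X)} {ν : ProbabilityMeasure (Path Y)}
    {π : ProbabilityMeasure (Path X × Path Y)}

/-- Along a causal plan, `h (y_{1:t})` may be replaced by its conditional mean given `x_{1:t}`,
even against functions of the whole path `x`. -/
lemma integral_mul_of_causal (hπ : π ∈ couplings μ ν) (hcaus : IsCausal π) {t : Fin T}
    (ht : t ∈ innerTimes T) (h : Past Y t →ᵇ ℝ) {k : Path X → ℝ} (hk : Measurable k) {C : ℝ}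
    (hC : ∀ x, ‖k x‖ ≤ C) :
    ∫ p, h (past t p.2) * k p.1 ∂(π : Measure (Path X × Path Y)) =
      ∫ x, responseMean π t h (past t x) * k x ∂(μ : Measure (Path X)) := by
  have hbound : ∀ q : Path X × Past Y t, ‖h q.2 * k q.1‖ ≤ ‖h‖ * C := by
    intro q
    rw [norm_mul]
    exact mul_le_mul (h.norm_coe_le_norm _) (hC _) (norm_nonneg _) (norm_nonneg _)
  rw [integral_eq_integral_condDistrib (P := (π : Measure (Path X × Path Y))) measurable_fst
    (measurable_past_snd t) (F := fun q : Path X × Past Y t => h q.2 * k q.1)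
    ((h.continuous.measurable.comp measurable_snd).mul (hk.comp measurable_fst)) hbound,
    ← integral_fst_of_mem_couplings hπ (k := fun x => responseMean π t h (past t x) * k x)
      (((measurable_responseMean t h.continuous.measurable).comp (measurable_past t)).mul hk)]
  have hae := ae_of_ae_map measurable_fst.aemeasurable (hcaus t ht)
  refine integral_congr_ae ?_
  filter_upwards [hae] with p hp
  rw [integral_mul_const, hp]
  rfl

variable [∀ t, TopologicalSpace (X t)] [∀ t, PolishSpace (X t)] [∀ t, BorelSpace (X t)]
    [∀ t, Nonempty (X t)]

/-- A causal plan annihilates the elementary test functions. -/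
lemma integral_test_eq_zero_of_causal (hπ : π ∈ couplings μ ν) (hcaus : IsCausal π) {t : Fin T}
    (ht : t ∈ innerTimes T) (h : Past Y t →ᵇ ℝ) (g : Path X →ᵇ ℝ) :
    ∫ p, h (past t p.2) * (g p.1 - condMean μ t g p.1) ∂(π : Measure (Path X × Path Y)) = 0 := by
  have hgm : Measurable g := g.continuous.measurable
  have hcm := measurable_condMean μ t hgm
  have hcb := norm_condMean_le μ t g.norm_coe_le_norm
  have hH := measurable_responseMean (π := π) t h.continuous.measurable
  have hHb : ∀ a, ‖responseMean π t h a‖ ≤ ‖h‖ := fun a =>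
    norm_integral_le_of_bound h.norm_coe_le_norm
  have hd : ∀ x, ‖g x - condMean μ t g x‖ ≤ ‖g‖ + ‖g‖ := fun x =>
    (norm_sub_le _ _).trans (add_le_add (g.norm_coe_le_norm x) (hcb x))
  rw [integral_mul_of_causal hπ hcaus ht h (k := fun x => g x - condMean μ t g x)
    (hgm.sub hcm) hd]
  simp only [mul_sub]
  have hHm : Measurable fun x => responseMean π t h (past t x) := hH.comp (measurable_past t)
  rw [integral_sub, integral_mul_condMean μ t hH hHb hgm g.norm_coe_le_norm, sub_self]
  · exact Integrable.of_bound (hHm.mul hgm).aestronglyMeasurable (‖h‖ * ‖g‖) (.of_forall fun x => by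
      rw [norm_mul]
      exact mul_le_mul (hHb _) (g.norm_coe_le_norm x) (norm_nonneg _) (norm_nonneg _))
  · exact Integrable.of_bound (hHm.mul hcm).aestronglyMeasurable (‖h‖ * ‖g‖) (.of_forall fun x => by
      rw [norm_mul]
      exact mul_le_mul (hHb _) (hcb x) (norm_nonneg _) (norm_nonneg _))

/-- A coupling that annihilates all elementary test functions is causal: products of bounded
continuous functions determine the joint law of `x` and `y_{1:t}`, which must therefore be the one
obtained by drawing `y_{1:t}` from its conditional law given `x_{1:t}` only. -/
lemma isCausal_of_integral_test_eq_zero (hπ : π ∈ couplings μ ν)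
    (hzero : ∀ t ∈ innerTimes T, ∀ (h : Past Y t →ᵇ ℝ) (g : Path X →ᵇ ℝ),
      ∫ p, h (past t p.2) * (g p.1 - condMean μ t g p.1) ∂(π : Measure (Path X × Path Y)) = 0) :
    IsCausal π := by
  intro t ht
  set κ := condDistrib (fun p : Path X × Path Y => past t p.2) (fun p => past t p.1)
    (π : Measure (Path X × Path Y)) with hκ
  have key : condDistrib (fun p : Path X × Path Y => past t p.2) Prod.fst
      (π : Measure (Path X × Path Y)) =ᵐ[(π : Measure (Path X × Path Y)).map Prod.fst]
      κ.comap (past t) (measurable_past t) := by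
    refine condDistrib_ae_eq_of_measure_eq_compProd _ (measurable_past_snd t).aemeasurable ?_
    have hfst : (π : Measure (Path X × Path Y)).map Prod.fst = μ := hπ.1
    have hpair : Measurable fun p : Path X × Path Y => (p.1, past t p.2) :=
      measurable_fst.prodMk (measurable_past_snd t)
    have : IsProbabilityMeasure ((π : Measure (Path X × Path Y)).map Prod.fst) :=
      Measure.isProbabilityMeasure_map measurable_fst.aemeasurable
    have : IsProbabilityMeasure
        ((π : Measure (Path X × Path Y)).map fun p => (p.1, past t p.2)) :=
      Measure.isProbabilityMeasure_map hpair.aemeasurable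
    refine Measure.ext_of_integral_mul_boundedContinuousFunction fun g h => ?_
    have hgm : Measurable g := g.continuous.measurable
    have hhm : Measurable h := h.continuous.measurable
    have hG := measurable_pastMean μ t hgm
    have hGb : ∀ a, ‖pastMean μ t g a‖ ≤ ‖g‖ := fun a =>
      norm_integral_le_of_bound fun _ => g.norm_coe_le_norm _
    have hcm := measurable_condMean μ t hgm
    have hcb := norm_condMean_le μ t g.norm_coe_le_norm
    have hH := measurable_responseMean (π := π) t hhm
    have hHb : ∀ a, ‖responseMean π t h a‖ ≤ ‖h‖ := fun a =>
      norm_integral_le_of_bound h.norm_coe_le_norm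
    have h0 := hzero t ht h g
    simp only [mul_sub] at h0
    rw [integral_sub (integrable_past_mul h hgm g.norm_coe_le_norm _)
      (integrable_past_mul h hcm hcb _), sub_eq_zero] at h0
    calc ∫ q, g q.1 * h q.2 ∂((π : Measure (Path X × Path Y)).map fun p => (p.1, past t p.2))
        = ∫ p, g p.1 * h (past t p.2) ∂(π : Measure (Path X × Path Y)) :=
          integral_map hpair.aemeasurable (by fun_prop)
      _ = ∫ p, h (past t p.2) * pastMean μ t g (past t p.1) ∂(π : Measure (Path X × Path Y)) := by
          simp only [mul_comm (g _)]
          exact h0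
      -- The integrand now sees `x` only through `x_{1:t}`, so disintegrating along `x_{1:t}` suffices.
      _ = ∫ p, responseMean π t h (past t p.1) * pastMean μ t g (past t p.1)
            ∂(π : Measure (Path X × Path Y)) := by
          rw [integral_eq_integral_condDistrib (P := (π : Measure (Path X × Path Y)))
            (measurable_past_fst t) (measurable_past_snd t)
            (F := fun q : Past X t × Past Y t => h q.2 * pastMean μ t g q.1)
            ((hhm.comp measurable_snd).mul (hG.comp measurable_fst)) (C := ‖h‖ * ‖g‖)]
          · simp only [integral_mul_const]
            rfl
          · intro q
            rw [norm_mul]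
            exact mul_le_mul (h.norm_coe_le_norm _) (hGb _) (norm_nonneg _) (norm_nonneg _)
      _ = ∫ x, responseMean π t h (past t x) * condMean μ t g x ∂(μ : Measure (Path X)) :=
          integral_fst_of_mem_couplings hπ
            (k := fun x => responseMean π t h (past t x) * condMean μ t g x)
            ((hH.comp (measurable_past t)).mul hcm)
      _ = ∫ x, responseMean π t h (past t x) * g x ∂(μ : Measure (Path X)) :=
          integral_mul_condMean μ t hH hHb hgm g.norm_coe_le_norm
      _ = ∫ q, g q.1 * h q.2 ∂(((π : Measure (Path X × Path Y)).map Prod.fst) ⊗ₘ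
            κ.comap (past t) (measurable_past t)) := by
          rw [Measure.integral_compProd, hfst]
          · refine integral_congr_ae (.of_forall fun x => ?_)
            simp only [integral_const_mul, Kernel.comap_apply]
            rw [mul_comm]
            rfl
          · refine Integrable.of_bound (by fun_prop) (‖g‖ * ‖h‖) (.of_forall fun q => ?_)
            rw [norm_mul]
            exact mul_le_mul (g.norm_coe_le_norm _) (h.norm_coe_le_norm _) (norm_nonneg _)
              (norm_nonneg _)
  filter_upwards [key] with x hx
  rw [hx, Kernel.comap_apply]

end Causality

/-! ### The space of test functions -/

section TestFunctions

variable {T : ℕ} {X Y : Fin T → Type*}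
    [∀ t, TopologicalSpace (X t)] [∀ t, PolishSpace (X t)]
    [∀ t, MeasurableSpace (X t)] [∀ t, BorelSpace (X t)] [∀ t, Nonempty (X t)]
    [∀ t, TopologicalSpace (Y t)]

/-- Index of the elementary test functions: an inner time `t`, a function of `y_{1:t}` and a
function of `x`. -/
abbrev TestIndex (X Y : Fin T → Type*) [∀ t, TopologicalSpace (X t)]
    [∀ t, TopologicalSpace (Y t)] :=
  Σ t : innerTimes T, (Past Y t.1 →ᵇ ℝ) × (Path X →ᵇ ℝ)

/-- The elementary test function `h(y_{1:t}) (g(x) - E[g | x_{1:t}])`. -/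
def elemTest (μ : ProbabilityMeasure (Path X)) (i : TestIndex X Y) (x : Path X) (y : Path Y) : ℝ :=
  i.2.1 (past i.1.1 y) * (i.2.2 x - condMean μ i.1.1 i.2.2 x)

variable (μ : ProbabilityMeasure (Path X))

lemma zero_mem_testFunctions : (fun _ _ => 0) ∈ testFunctions Y μ :=
  ⟨1, fun _ _ => 0, fun _ _ => 0, one_pos, by simp⟩

lemma add_mem_testFunctions {γ γ' : Path X → Path Y → ℝ} (hγ : γ ∈ testFunctions Y μ)
    (hγ' : γ' ∈ testFunctions Y μ) : (fun x y => γ x y + γ' x y) ∈ testFunctions Y μ := by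
  obtain ⟨L, h, g, hL, hg⟩ := hγ
  obtain ⟨L', h', g', -, hg'⟩ := hγ'
  refine ⟨L + L', Fin.append h h', Fin.append g g', by omega, fun x y => ?_⟩
  simp [Fin.sum_univ_add, hg, hg']

lemma smul_elemTest_mem_testFunctions (w : ℝ) (i : TestIndex X Y) :
    (fun x y => w * elemTest μ i x y) ∈ testFunctions Y μ := by
  classical
  obtain ⟨⟨t, ht⟩, h, g⟩ := i
  refine ⟨1, fun _ => Function.update (fun _ => 0) t (w • h), fun _ _ => g, one_pos, fun x y => ?_⟩
  rw [Fin.sum_univ_one, Finset.sum_eq_single_of_mem t ht]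
  · simp [elemTest, mul_assoc]
  · intro t' _ hne
    simp [Function.update_of_ne hne]

lemma sum_elemTest_mem_testFunctions (s : Finset (TestIndex X Y)) (w : TestIndex X Y → ℝ) :
    (fun x y => ∑ i ∈ s, w i * elemTest μ i x y) ∈ testFunctions Y μ := by
  classical
  induction s using Finset.induction_on with
  | empty => simpa using zero_mem_testFunctions μ
  | insert i s hi ih =>
    simp only [Finset.sum_insert hi]
    exact add_mem_testFunctions μ (smul_elemTest_mem_testFunctions μ (w i) i) ih

lemma measurable_sub_condMean (t : Fin T) (g : Path X →ᵇ ℝ) :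
    Measurable fun x => g x - condMean μ t g x :=
  g.continuous.measurable.sub (measurable_condMean μ t g.continuous.measurable)

lemma norm_sub_condMean_le (t : Fin T) (g : Path X →ᵇ ℝ) (x : Path X) :
    ‖g x - condMean μ t g x‖ ≤ ‖g‖ + ‖g‖ :=
  (norm_sub_le _ _).trans
    (add_le_add (g.norm_coe_le_norm x) (norm_condMean_le μ t g.norm_coe_le_norm x))

lemma exists_bound_elemTest (i : TestIndex X Y) :
    ∃ C, ∀ x (y : Path Y), ‖elemTest μ i x y‖ ≤ C := by
  refine ⟨‖i.2.1‖ * (‖i.2.2‖ + ‖i.2.2‖), fun x y => ?_⟩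
  rw [elemTest, norm_mul]
  exact mul_le_mul (i.2.1.norm_coe_le_norm _) (norm_sub_condMean_le μ _ _ _) (norm_nonneg _)
    (norm_nonneg _)

lemma exists_bound_sum_elemTest (s : Finset (TestIndex X Y)) (w : TestIndex X Y → ℝ) :
    ∃ C, ∀ x (y : Path Y), ‖∑ i ∈ s, w i * elemTest μ i x y‖ ≤ C := by
  choose C hC using exists_bound_elemTest (Y := Y) μ
  refine ⟨∑ i ∈ s, ‖w i‖ * C i, fun x y => norm_sum_le_of_le _ fun i _ => ?_⟩
  rw [norm_mul]
  exact mul_le_mul_of_nonneg_left (hC i x y) (norm_nonneg _)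

variable [∀ t, PolishSpace (Y t)] [∀ t, MeasurableSpace (Y t)] [∀ t, BorelSpace (Y t)]

lemma integrable_elemTest (i : TestIndex X Y) (P : Measure (Path X × Path Y))
    [IsFiniteMeasure P] : Integrable (fun p => elemTest μ i p.1 p.2) P :=
  integrable_past_mul i.2.1 (measurable_sub_condMean μ _ i.2.2) (norm_sub_condMean_le μ _ i.2.2) P

lemma continuousOn_integral_elemTest (ν : ProbabilityMeasure (Path Y)) (i : TestIndex X Y) :
    ContinuousOn (fun π : ProbabilityMeasure (Path X × Path Y) =>
      ∫ p, elemTest μ i p.1 p.2 ∂(π : Measure (Path X × Path Y))) (couplings μ ν) :=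
  continuousOn_integral_mul μ ν (i.2.1.compContinuous ⟨past i.1.1, continuous_past _⟩)
    (Integrable.of_bound (measurable_sub_condMean μ i.1.1 i.2.2).aestronglyMeasurable _
      (.of_forall (norm_sub_condMean_le μ _ i.2.2)))

variable [∀ t, Nonempty (Y t)] {μ}

/-- Test functions are integrable and centred under causal couplings. -/
lemma integrable_and_integral_eq_zero_of_causal {ν : ProbabilityMeasure (Path Y)}
    {π : ProbabilityMeasure (Path X × Path Y)} (hπ : π ∈ couplings μ ν) (hcaus : IsCausal π)
    {γ : Path X → Path Y → ℝ} (hγ : γ ∈ testFunctions Y μ) :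
    Integrable (fun p => γ p.1 p.2) (π : Measure (Path X × Path Y)) ∧
      ∫ p, γ p.1 p.2 ∂(π : Measure (Path X × Path Y)) = 0 := by
  obtain ⟨L, h, g, -, hg⟩ := hγ
  have hint : ∀ l : Fin L, ∀ t ∈ innerTimes T, Integrable (fun p : Path X × Path Y =>
      h l t (past t p.2) * (g l t p.1 - condMean μ t (g l t) p.1))
      (π : Measure (Path X × Path Y)) := fun l t ht =>
    integrable_elemTest μ ⟨⟨t, ht⟩, h l t, g l t⟩ _
  simp only [hg]
  refine ⟨integrable_finsetSum _ fun l _ => integrable_finsetSum _ (hint l), ?_⟩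
  rw [integral_finsetSum _ fun l _ => integrable_finsetSum _ (hint l)]
  refine Finset.sum_eq_zero fun l _ => ?_
  rw [integral_finsetSum _ (hint l)]
  exact Finset.sum_eq_zero fun t ht => integral_test_eq_zero_of_causal hπ hcaus ht _ _

end TestFunctions

/-! ### Duality for a fixed second marginal -/

section Duality

variable {T : ℕ} {X Y : Fin T → Type*}
    [∀ t, TopologicalSpace (X t)] [∀ t, PolishSpace (X t)]
    [∀ t, MeasurableSpace (X t)] [∀ t, BorelSpace (X t)] [∀ t, Nonempty (X t)]
    [∀ t, TopologicalSpace (Y t)] [∀ t, PolishSpace (Y t)]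
    [∀ t, MeasurableSpace (Y t)] [∀ t, BorelSpace (Y t)] [∀ t, Nonempty (Y t)]
    {μ : ProbabilityMeasure (Path X)} {ν : ProbabilityMeasure (Path Y)}
    {c : Path X × Path Y → ℝ≥0} {ε : ℝ}

/-- If the causal transport cost exceeds `ε`, then a test function and a positive multiplier detect
this on all couplings of finite cost at once. -/
lemma exists_multipliers_of_lt_causalCost (hc : LowerSemicontinuous c) (hε : 0 ≤ ε)
    (hlt : ENNReal.ofReal ε < causalCost c μ ν) :
    ∃ (s : Finset (TestIndex X Y)) (w : TestIndex X Y → ℝ) (lam δ : ℝ), 0 < lam ∧ 0 < δ ∧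
      ∀ π ∈ couplings μ ν, ∫⁻ p, (c p : ℝ≥0∞) ∂(π : Measure (Path X × Path Y)) ≠ ⊤ →
        lam * (ε - (∫⁻ p, (c p : ℝ≥0∞) ∂(π : Measure (Path X × Path Y))).toReal) +
          ∑ i ∈ s, w i * ∫ p, elemTest μ i p.1 p.2 ∂(π : Measure (Path X × Path Y)) ≤ -δ := by
  have : CompactSpace (couplings μ ν) := isCompact_iff_compactSpace.1 (isCompact_couplings μ ν)
  have key := exists_multipliers (K := couplings μ ν)
    (A := fun (i : TestIndex X Y) π => ∫ p, elemTest μ i p.1 p.2 ∂(π.1 : Measure (Path X × Path Y)))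
    (C := fun π => ∫⁻ p, (c p : ℝ≥0∞) ∂(π.1 : Measure (Path X × Path Y)))
    (fun i => (continuousOn_integral_elemTest μ ν i).domRestrict)
    ((lowerSemicontinuous_lintegral hc).comp continuous_subtype_val)
  obtain ⟨s, w, lam, δ, hlam, hδ, h⟩ := key
    (by
      rintro ⟨π, hπ⟩ ⟨ρ, hρ⟩ a b ha hb hab
      obtain ⟨σ, hσ, hσeq⟩ := exists_mixture hπ hρ ha hb hab
      refine ⟨⟨σ, hσ⟩, fun i => ?_, ?_⟩
      · dsimp only
        rw [hσeq, integral_add_measure, integral_smul_measure, integral_smul_measure,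
          ENNReal.toReal_ofReal ha, ENNReal.toReal_ofReal hb, smul_eq_mul, smul_eq_mul]
        · exact (integrable_elemTest μ i _).smul_measure ENNReal.ofReal_ne_top
        · exact (integrable_elemTest μ i _).smul_measure ENNReal.ofReal_ne_top
      · rw [hσeq, lintegral_add_measure, lintegral_smul_measure, lintegral_smul_measure,
          smul_eq_mul, smul_eq_mul])
    hε
    (by
      rintro ⟨π, hπ⟩ hzero
      have hcaus : IsCausal π := isCausal_of_integral_test_eq_zero hπ
        fun t ht h g => hzero ⟨⟨t, ht⟩, h, g⟩
      exact hlt.trans_le (iInf₂_le π ⟨hπ, hcaus⟩))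
  exact ⟨s, w, lam, δ, hlam, hδ, fun π hπ => h ⟨π, hπ⟩⟩

/-- Outside of the causal ball, the penalised problem has value `-∞`: the multipliers of
`exists_multipliers_of_lt_causalCost` can be scaled up. -/
lemma exists_penalised_le (hc : LowerSemicontinuous c) (hε : 0 ≤ ε)
    (hlt : ENNReal.ofReal ε < causalCost c μ ν) {f : Path Y → ℝ} {B : ℝ} (hB : ∀ y, f y ≤ B)
    (M : ℝ) :
    ∃ (lam : ℝ≥0) (γ : Path X → Path Y → ℝ), γ ∈ testFunctions Y μ ∧
      (((lam : ℝ) * ε : ℝ) : EReal) +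
        ⨆ π ∈ couplings μ ν, eintegral (π : Measure (Path X × Path Y))
          (fun p => f p.2 - (lam : ℝ) * (c p : ℝ) + γ p.1 p.2) ≤ (M : EReal) := by
  obtain ⟨s, w, lam, δ, hlam, hδ, h⟩ := exists_multipliers_of_lt_causalCost hc hε hlt
  obtain ⟨n, hn0, hn⟩ : ∃ n : ℝ, 0 < n ∧ B - n * δ ≤ M := by
    refine ⟨max 1 ((B - M) / δ), by positivity, ?_⟩
    have := le_max_right 1 ((B - M) / δ)
    rw [div_le_iff₀ hδ] at this
    linarith
  have hγ := sum_elemTest_mem_testFunctions (Y := Y) μ s (fun i => n * w i)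
  set γ : Path X → Path Y → ℝ := fun x y => ∑ i ∈ s, n * w i * elemTest μ i x y with hγdef
  have hcm : Measurable c := hc.measurable
  refine ⟨⟨n * lam, by positivity⟩, γ, hγ, ?_⟩
  change ((n * lam * ε : ℝ) : EReal) + (⨆ π ∈ couplings μ ν,
    eintegral (π : Measure (Path X × Path Y))
      (fun p => f p.2 - n * lam * (c p : ℝ) + γ p.1 p.2)) ≤ _
  have hM : (M : EReal) = ((n * lam * ε : ℝ) : EReal) + ((M - n * lam * ε : ℝ) : EReal) := by
    rw [← EReal.coe_add]
    congr 1
    ring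
  rw [hM]
  refine add_le_add le_rfl (iSup₂_le fun π hπ => ?_)
  obtain ⟨G, hG⟩ := exists_bound_sum_elemTest (Y := Y) μ s (fun i => n * w i)
  -- Only the upper bound `B` of `f` matters here, so `f` need not be integrable.
  refine (eintegral_mono (g' := fun p => (B + γ p.1 p.2) - n * lam * (c p : ℝ))
    fun p => by linarith [hB p.2]).trans ?_
  by_cases htop : ∫⁻ p, (c p : ℝ≥0∞) ∂(π : Measure (Path X × Path Y)) = ⊤
  · rw [eintegral_sub_mul_eq_bot hcm (C := B + G)
      (fun p => by linarith [(le_abs_self _).trans (hG p.1 p.2)]) (by positivity) htop]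
    exact bot_le
  have hcint := integrable_coe_of_lintegral_ne_top hcm htop
  have hcval := integral_coe_eq_toReal_lintegral (μ := (π : Measure (Path X × Path Y))) hcm
  have hterm : ∀ i ∈ s, Integrable (fun p => n * w i * elemTest μ i p.1 p.2)
      (π : Measure (Path X × Path Y)) := fun i _ => (integrable_elemTest μ i _).const_mul _
  have hγint : Integrable (fun p => γ p.1 p.2) (π : Measure (Path X × Path Y)) :=
    integrable_finsetSum _ hterm
  have hγval : ∫ p, γ p.1 p.2 ∂(π : Measure (Path X × Path Y)) =
      n * ∑ i ∈ s, w i * ∫ p, elemTest μ i p.1 p.2 ∂(π : Measure (Path X × Path Y)) := by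
    rw [hγdef, integral_finsetSum _ hterm, Finset.mul_sum]
    exact Finset.sum_congr rfl fun i _ => by rw [integral_const_mul, mul_assoc]
  have hBγ : Integrable (fun p => B + γ p.1 p.2) (π : Measure (Path X × Path Y)) :=
    (integrable_const B).add hγint
  rw [eintegral_eq_integral (g := fun p => B + γ p.1 p.2 - n * lam * (c p : ℝ))
      (hBγ.sub (hcint.const_mul _)), integral_sub hBγ (hcint.const_mul _),
    integral_add (integrable_const B) hγint, integral_const_mul, hγval, hcval, integral_const]
  simp only [probReal_univ, one_smul]
  have := mul_le_mul_of_nonneg_left (h π hπ htop) hn0.le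
  exact EReal.coe_le_coe_iff.2 (by linarith)

/-- Weak duality at a measure in the causal ball: near-optimal causal couplings annihilate the test
functions and cost at most slightly more than `ε`. -/
lemma eintegral_le_penalised (hc : LowerSemicontinuous c) (hε : 0 ≤ ε)
    (hν : ν ∈ causalBall c μ ε) {f : Path Y → ℝ} (hf : Measurable f) {B : ℝ}
    (hB : ∀ y, f y ≤ B) (lam : ℝ≥0) {γ : Path X → Path Y → ℝ} (hγ : γ ∈ testFunctions Y μ) :
    eintegral (ν : Measure (Path Y)) f ≤ (((lam : ℝ) * ε : ℝ) : EReal) +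
      ⨆ π ∈ couplings μ ν, eintegral (π : Measure (Path X × Path Y))
        (fun p => f p.2 - (lam : ℝ) * (c p : ℝ) + γ p.1 p.2) := by
  by_cases hbot : eintegral (ν : Measure (Path Y)) f = ⊥
  · rw [hbot]
    exact bot_le
  have hfint := integrable_of_eintegral_ne_bot hf hB hbot
  have hcm : Measurable c := hc.measurable
  rw [eintegral_eq_integral hfint, ← EReal.ge_of_forall_gt_iff_ge]
  intro z hz
  rw [EReal.coe_lt_coe_iff] at hz
  set I := ∫ y, f y ∂(ν : Measure (Path Y)) with hI
  -- The slack `e` in the cost is small enough that `λ e ≤ I - z`.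
  set e := (I - z) / (lam + 1) with he
  have hlam1 : (0 : ℝ) < lam + 1 := by positivity
  have he0 : 0 < e := div_pos (by linarith) hlam1
  have hlt : causalCost c μ ν < ENNReal.ofReal (ε + e) :=
    lt_of_le_of_lt hν ((ENNReal.ofReal_lt_ofReal_iff (by linarith)).2 (by linarith))
  obtain ⟨π, ⟨hπ, hcaus⟩, hπc⟩ : ∃ π, (π ∈ couplings μ ν ∧ IsCausal π) ∧
      ∫⁻ p, (c p : ℝ≥0∞) ∂(π : Measure (Path X × Path Y)) < ENNReal.ofReal (ε + e) := by
    simpa [causalCost, iInf_lt_iff, and_assoc] using hlt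
  have htop : ∫⁻ p, (c p : ℝ≥0∞) ∂(π : Measure (Path X × Path Y)) ≠ ⊤ := hπc.ne_top
  have hcint := integrable_coe_of_lintegral_ne_top hcm htop
  have hcval : ∫ p, (c p : ℝ) ∂(π : Measure (Path X × Path Y)) ≤ ε + e := by
    rw [integral_coe_eq_toReal_lintegral hcm]
    exact ENNReal.toReal_le_of_le_ofReal (by linarith) hπc.le
  obtain ⟨hγint, hγ0⟩ := integrable_and_integral_eq_zero_of_causal hπ hcaus hγ
  have hsnd : MeasurePreserving Prod.snd (π : Measure (Path X × Path Y)) (ν : Measure (Path Y)) :=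
    ⟨measurable_snd, hπ.2⟩
  have hfint' : Integrable (fun p : Path X × Path Y => f p.2) (π : Measure (Path X × Path Y)) :=
    hsnd.integrable_comp_of_integrable hfint
  have hfval : ∫ p, f p.2 ∂(π : Measure (Path X × Path Y)) = I := by
    rw [hI, ← hsnd.map_eq, integral_map hsnd.aemeasurable hf.aestronglyMeasurable]
  refine le_trans ?_ (add_le_add le_rfl (le_iSup₂_of_le π hπ le_rfl))
  have hfc : Integrable (fun p : Path X × Path Y => f p.2 - (lam : ℝ) * (c p : ℝ))
      (π : Measure (Path X × Path Y)) := hfint'.sub (hcint.const_mul _)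
  rw [eintegral_eq_integral (g := fun p => f p.2 - (lam : ℝ) * (c p : ℝ) + γ p.1 p.2)
    (hfc.add hγint), integral_add hfc hγint, hγ0, add_zero]
  rw [integral_sub hfint' (hcint.const_mul _), hfval, integral_const_mul, ← EReal.coe_add]
  refine EReal.coe_le_coe_iff.2 ?_
  have h1 := mul_le_mul_of_nonneg_left hcval lam.2
  have h2 : e * (lam + 1) = I - z := by rw [he]; field_simp
  have h3 : (lam : ℝ) * (ε + e) = lam * ε + (e * (lam + 1) - e) := by ring
  change (lam : ℝ) * _ ≤ (lam : ℝ) * _ at h1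
  linarith

end Duality

end SCOT

end

theorem theorem2 {T : ℕ} {X Y : Fin T → Type*}
    [∀ t, TopologicalSpace (X t)] [∀ t, PolishSpace (X t)]
    [∀ t, MeasurableSpace (X t)] [∀ t, BorelSpace (X t)] [∀ t, Nonempty (X t)]
    [∀ t, TopologicalSpace (Y t)] [∀ t, PolishSpace (Y t)]
    [∀ t, MeasurableSpace (Y t)] [∀ t, BorelSpace (Y t)] [∀ t, Nonempty (Y t)]
    (μ : ProbabilityMeasure (∀ t, X t))
    (f : (∀ t, Y t) → ℝ) (hf : UpperSemicontinuous f) (hf_bdd : BddAbove (Set.range f))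
    (c : (∀ t, X t) × (∀ t, Y t) → ℝ≥0) (hc : LowerSemicontinuous c)
    (V : Set (ProbabilityMeasure (∀ t, Y t))) (hV : V.Nonempty)
    (ε : ℝ) (hε : 0 < ε) (hball : (SCOT.causalBall c μ ε).Nonempty) :
    SCOT.primalValue f c μ ε V = SCOT.dualValue f c μ ε V := by
  obtain ⟨B, hB⟩ := hf_bdd
  have hB' : ∀ y, f y ≤ B := fun y => hB ⟨y, rfl⟩
  have hfm : Measurable f := hf.measurable
  apply le_antisymm
  · refine iSup₂_le fun ν hν => le_iSup₂_of_le ν hν.2 ?_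
    exact le_iInf fun lam => le_iInf₂ fun γ hγ =>
      SCOT.eintegral_le_penalised hc hε.le hν.1 hfm hB' lam hγ
  · refine iSup₂_le fun ν hν => ?_
    by_cases hmem : ν ∈ SCOT.causalBall c μ ε
    · refine le_iSup₂_of_le ν ⟨hmem, hν⟩ ?_
      refine iInf_le_of_le 0 (iInf₂_le_of_le _ (SCOT.zero_mem_testFunctions μ) ?_)
      simp only [NNReal.coe_zero, zero_mul, EReal.coe_zero, zero_add, sub_zero, add_zero]
      refine iSup₂_le fun π hπ => ?_
      rw [← hπ.2, Measure.snd, SCOT.eintegral_map measurable_snd hfm]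
    · have hlt : ENNReal.ofReal ε < SCOT.causalCost c μ ν := not_le.1 hmem
      refine le_trans (le_of_eq ?_) bot_le
      refine (EReal.eq_bot_iff_forall_lt _).2 fun M => ?_
      obtain ⟨lam, γ, hγ, hle⟩ := SCOT.exists_penalised_le hc hε.le hlt hB' (M - 1)
      refine lt_of_le_of_lt (iInf_le_of_le lam (iInf₂_le_of_le γ hγ hle)) ?_
      exact EReal.coe_lt_coe_iff.2 (by linarith)
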